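/- \textbf{Theorem.} In the LOCAL model, the nodes of a finite simple undirected graph $G=(V,E)$ carry arbitrary distinct natural numbers as identifiers and all run the same deterministic algorithm. Initially a node knows only its own identifier and the identifiers of its neighbours. In each synchronous round every node sends a message of unbounded size to each of its neighbours, receives the messages of its neighbours, and updates its state by an arbitrary function of its old state and the received messages. At some round (possibly round $0$, before any communication) each node irrevocably announces its output; it may continue to relay messages afterwards. The running time is the number of rounds after which all nodes have announced their outputs. An orientation of $G$ directs each edge $\{u,v\}\in E$ in exactly one way, either from $u$ to $v$ or from $v$ to $u$. It is stable if every edge directed from $u$ to $v$ satisfies $\mathrm{indeg}(v)\le \mathrm{indeg}(u)+1$, where $\mathrm{indeg}(w)$ is the number of edges directed towards $w$. There are a single deterministic LOCAL algorithm, which is given neither the number of nodes nor the maximum degree of the graph, and an absolute constant $C$, such that for every finite simple graph $G$ of maximum degree $\Delta$ and every assignment of distinct identifiers, the algorithm finds a stable orientation of $G$ within $C\cdot\Delta^4$ rounds: each node $v$ outputs the set of the identifiers of exactly those neighbours $u$ whose edge $\{u,v\}$ is directed towards $v$. In particular the running time is $O(\Delta^4)$, independent of the number of nodes. -/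

import Mathlib

/-- `D` is an orientation of the simple graph `G`: every arc of `D` lies on an edge of `G`, and
every edge of `G` is directed in exactly one of its two directions.  `D.Adj u v` means that the
edge `{u, v}` is oriented from `u` to `v`, so `v` is its head. -/
def IsOrientation {V : Type} (G : SimpleGraph V) (D : Digraph V) : Prop :=
  (∀ u v, D.Adj u v → G.Adj u v) ∧ ∀ u v, G.Adj u v → Xor (D.Adj u v) (D.Adj v u)

/-- The indegree (load) of a node: the number of arcs that point to it. -/
noncomputable def indeg {V : Type} (D : Digraph V) (v : V) : ℕ :=
  {u | D.Adj u v}.ncard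

/-- A stable orientation of `G`: an orientation in which every oriented edge is happy. -/
def IsStableOrientation {V : Type} (G : SimpleGraph V) (D : Digraph V) : Prop :=
  IsOrientation G D ∧ ∀ u v, D.Adj u v → indeg D v ≤ indeg D u + 1

/-- A deterministic algorithm in the LOCAL model.  All nodes run the same algorithm; local
computation and the size of states and messages are unbounded.  Nothing in this structure can
depend on the input graph, on its number of nodes, or on its maximum degree. -/
structure LocalAlgorithm (Out : Type) where
  /-- The possible states of a node. -/
  State : Type
  /-- The possible messages. -/
  Msg : Type
  /-- The initial state, from the node's own identifier and the identifiers of its neighbours. -/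
  init : ℕ → Finset ℕ → State
  /-- The message that a node sends to the neighbour with the given identifier. -/
  send : State → ℕ → Msg
  /-- The new state, from the old one and the messages received in this round, each of them
  together with the identifier of the neighbour that sent it. -/
  recv : State → Finset (ℕ × Msg) → State
  /-- The output that a node announces in the given state, or `none` if it is undecided. -/
  output : State → Option Out

namespace LocalAlgorithm

variable {Out : Type} (A : LocalAlgorithm Out)
  {V : Type} [Fintype V] (G : SimpleGraph V) [DecidableRel G.Adj] (ident : V ↪ ℕ)

/-- The state of each node after `t` synchronous communication rounds of `A` on the graph `G`,
whose nodes have the unique identifiers `ident`. -/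
def stateAt : ℕ → V → A.State
  | 0, v => A.init (ident v) ((G.neighborFinset v).map ident)
  | t + 1, v => A.recv (stateAt t v) ((G.neighborFinset v).map
      ⟨fun u => (ident u, A.send (stateAt t u) (ident v)),
        fun _ _ h => ident.injective (congrArg Prod.fst h)⟩)

/-- Node `v` announces the output `o` after exactly `t` rounds: `t` is the first time at which it
announces anything.  This first announcement is its irrevocable output, although the node may
go on to exchange messages with its neighbours afterwards. -/
def AnnouncesAt (v : V) (t : ℕ) (o : Out) : Prop :=
  A.output (A.stateAt G ident t v) = some o ∧
    ∀ s < t, A.output (A.stateAt G ident s v) = none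

/-- On the graph `G` with identifiers `ident`, the algorithm outputs the orientation `D` within
`T` rounds: after at most `T` rounds every node has announced the set of the identifiers
of those neighbours `u` for which the edge `{u, v}` is oriented towards `v`. -/
def FindsOrientationWithin (A : LocalAlgorithm (Finset ℕ)) (D : Digraph V) (T : ℕ) : Prop :=
  ∀ v, ∃ t ≤ T, ∃ o : Finset ℕ,
    A.AnnouncesAt G ident v t o ∧ (o : Set ℕ) = ident '' {u | D.Adj u v}

end LocalAlgorithm

/-! Orient the edges in phases, keeping every oriented edge happy. In a phase, each unoriented edge
proposes to its endpoint of lower load and each node accepts at most one proposal. Loads grow by at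
most one, so with the old loads as levels the excess loads are tokens. Reversing an arc from `v` to
`p` moves a token from `p` one level down to `v`; once no token can move, all arcs are happy again
(`IsGame.happy`).

If all degrees are at most `d`, a token game lasts at most `d ^ 3` rounds (`Active.time_lt`). A move
still possible at time `t` is traced back along the earlier path of its token and of its empty slot.
The trails cover at most `d` nodes, one of which is active in every round up to `t`, while a node is
active at most `d ^ 2` times (`card_active_le`). An unoriented edge has an endpoint accepting an
edge in each phase, so `2 * d` phases suffice (`not_unoriented_phases`), and information travels a
distance of order `d ^ 4`.

The degree bound is unknown to the nodes. Hence the orientation `limit` is defined by running games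
and phases until they stabilise. Stabilisation at a node needs degree bounds only nearby, so a ball
of radius `18 * d ^ 4` determines its arcs (`limit_congr`). In `gather` a node collects its
surroundings until every graph compatible with them gives it the same in-neighbours. -/

/-- `P` holds at every node that can be reached from `v` by a walk of length at most `n`. -/
def AllNear {V : Type*} (H : SimpleGraph V) (P : V → Prop) : ℕ → V → Prop
  | 0, v => P v
  | n + 1, v => P v ∧ ∀ u, H.Adj v u → AllNear H P n u

namespace AllNear

variable {V : Type*} {H H' : SimpleGraph V} {P Q : V → Prop}

theorem self : ∀ {n : ℕ} {v : V}, AllNear H P n v → P v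
  | 0, _, h => h
  | _ + 1, _, h => h.1

theorem adj {n : ℕ} {v u : V} (h : AllNear H P (n + 1) v) (e : H.Adj v u) : AllNear H P n u :=
  h.2 u e

theorem pred {n : ℕ} {v : V} (h : AllNear H P (n + 1) v) : AllNear H P n v := by
  induction n generalizing v with
  | zero => exact h.1
  | succ n ih => exact ⟨h.1, fun u e => ih (h.2 u e)⟩

theorem mono {m n : ℕ} (hmn : m ≤ n) {v : V} (h : AllNear H P n v) : AllNear H P m v := by
  induction hmn with
  | refl => exact h
  | step _ ih => exact ih h.pred

theorem of_forall (h : ∀ v, P v) : ∀ (n : ℕ) (v : V), AllNear H P n v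
  | 0, v => h v
  | n + 1, v => ⟨h v, fun u _ => of_forall h n u⟩

theorem imp (h : ∀ v, P v → Q v) {n : ℕ} {v : V} (hv : AllNear H P n v) : AllNear H Q n v := by
  induction n generalizing v with
  | zero => exact h v hv
  | succ n ih => exact ⟨h v hv.1, fun u e => ih (hv.2 u e)⟩

theorem and {n : ℕ} {v : V} (hP : AllNear H P n v) (hQ : AllNear H Q n v) :
    AllNear H (fun u => P u ∧ Q u) n v := by
  induction n generalizing v with
  | zero => exact ⟨hP, hQ⟩
  | succ n ih => exact ⟨⟨hP.1, hQ.1⟩, fun u e => ih (hP.2 u e) (hQ.2 u e)⟩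

theorem nest {m n : ℕ} {v : V} (h : AllNear H P (m + n) v) : AllNear H (AllNear H P n) m v := by
  induction m generalizing v with
  | zero =>
    rw [Nat.zero_add] at h
    exact h
  | succ m ih =>
    rw [Nat.add_right_comm] at h
    exact ⟨h.mono (by omega), fun u e => ih (h.2 u e)⟩

theorem transfer {n : ℕ} {v : V}
    (h : AllNear H (fun u => (∀ w, H.Adj u w ↔ H'.Adj u w) ∧ P u) n v) : AllNear H' P n v := by
  induction n generalizing v with
  | zero => exact h.2
  | succ n ih => exact ⟨h.1.2, fun u e => ih (h.2 u ((h.1.1 u).2 e))⟩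

end AllNear

/-! ### The token dropping game -/

namespace TokenDropping

variable {V : Type*}

/-- The number of arcs of the relation `a` that point to `v`. -/
noncomputable def load (a : V → V → Prop) (v : V) : ℕ := {u | a u v}.ncard

/-- A token can move from `p` down to `v` by reversing the arc from `v` to `p`. -/
def Avail (ℓ : V → ℕ) (a : V → V → Prop) (p v : V) : Prop := a v p ∧ ℓ p = ℓ v + 1

/-- A node holds a token if its load exceeds its level. -/
def Occ (ℓ : V → ℕ) (a : V → V → Prop) (v : V) : Prop := ℓ v < load a v

/-- The empty node `v` could receive the token held by `p`. -/
def Wants (ℓ : V → ℕ) (a : V → V → Prop) (v p : V) : Prop :=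
  ¬ Occ ℓ a v ∧ Occ ℓ a p ∧ Avail ℓ a p v

/-- Some token could move to `v`. -/
def Active (ℓ : V → ℕ) (a : V → V → Prop) (v : V) : Prop := ∃ p, Wants ℓ a v p

/-- The arcs `a` form a partial orientation of `H` in which every node has a load equal to its
level or one more, and every arc climbs by at most one level. -/
structure IsGame (H : SimpleGraph V) (ℓ : V → ℕ) (a : V → V → Prop) : Prop where
  adj : ∀ u v, a u v → H.Adj u v
  asymm : ∀ u v, a u v → ¬ a v u
  load : ∀ v, load a v = ℓ v ∨ load a v = ℓ v + 1
  climb : ∀ u v, a u v → ℓ v ≤ ℓ u + 1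

/-- The arcs `a` form a partial orientation of `H` in which every arc is happy. -/
structure IsPartial (H : SimpleGraph V) (a : V → V → Prop) : Prop where
  adj : ∀ u v, a u v → H.Adj u v
  asymm : ∀ u v, a u v → ¬ a v u
  happy : ∀ u v, a u v → load a v ≤ load a u + 1

/-- The degree of `v` is at most `d`. -/
def DegLE (H : SimpleGraph V) (d : ℕ) (v : V) : Prop :=
  (H.neighborSet v).Finite ∧ (H.neighborSet v).ncard ≤ d

/-- The graphs `H` and `H'` agree at `v`. -/
def SameNbrs (H H' : SimpleGraph V) (v : V) : Prop := ∀ u, H.Adj v u ↔ H'.Adj v u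

/-- The relations `a` and `b` have the same arcs at `v`. -/
def SameArcs (a b : V → V → Prop) (v : V) : Prop :=
  (∀ u, a u v ↔ b u v) ∧ ∀ u, a v u ↔ b v u

theorem SameArcs.load_eq {a b : V → V → Prop} {v : V} (h : SameArcs a b v) :
    load a v = load b v := by
  simp only [load, h.1]

theorem SameArcs.symm {a b : V → V → Prop} {v : V} (h : SameArcs a b v) : SameArcs b a v :=
  ⟨fun u => (h.1 u).symm, fun u => (h.2 u).symm⟩

theorem SameArcs.trans {a b c : V → V → Prop} {v : V} (h : SameArcs a b v)
    (h' : SameArcs b c v) : SameArcs a c v :=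
  ⟨fun u => (h.1 u).trans (h'.1 u), fun u => (h.2 u).trans (h'.2 u)⟩

theorem SameArcs.refl (a : V → V → Prop) (v : V) : SameArcs a a v :=
  ⟨fun _ => Iff.rfl, fun _ => Iff.rfl⟩

theorem DegLE.congr {H H' : SimpleGraph V} {d : ℕ} {v : V} (h : SameNbrs H H' v)
    (hd : DegLE H d v) : DegLE H' d v := by
  have : H'.neighborSet v = H.neighborSet v := by
    ext u; exact (h u).symm
  rwa [DegLE, this]

theorem finite_arcs {H : SimpleGraph V} {a : V → V → Prop} {v : V}
    (ha : ∀ u v, a u v → H.Adj u v) (hv : (H.neighborSet v).Finite) : {u | a u v}.Finite :=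
  hv.subset fun _ h => (ha _ _ h).symm

theorem load_le {H : SimpleGraph V} {a : V → V → Prop} {d : ℕ} {v : V}
    (ha : ∀ u v, a u v → H.Adj u v) (hv : DegLE H d v) : load a v ≤ d :=
  (Set.ncard_le_ncard (fun _ h => (ha _ _ h).symm) hv.1).trans hv.2

theorem IsGame.level_le {H : SimpleGraph V} {ℓ : V → ℕ} {a : V → V → Prop} {d : ℕ}
    (hg : IsGame H ℓ a) {v : V} (hv : DegLE H d v) : ℓ v ≤ d := by
  have h1 := load_le hg.adj hv
  have h2 := hg.load v
  omega

theorem wants_congr {H : SimpleGraph V} {ℓ ℓ' : V → ℕ} {a a' : V → V → Prop}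
    (ha : ∀ u v, a u v → H.Adj u v) {v : V}
    (h : AllNear H (fun u => ℓ u = ℓ' u ∧ SameArcs a a' u) 1 v) (p : V) :
    Wants ℓ a v p ↔ Wants ℓ' a' v p := by
  have key : a v p → (Wants ℓ a v p ↔ Wants ℓ' a' v p) := fun hvp => by
    have hv := h.1
    have hp : ℓ p = ℓ' p ∧ SameArcs a a' p := h.2 p (ha _ _ hvp)
    simp only [Wants, Occ, Avail, hv.1, hp.1, hv.2.load_eq, hp.2.load_eq, hv.2.2 p]
  constructor
  · exact fun hw => (key hw.2.2.1).1 hw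
  · exact fun hw => (key ((h.1.2.2 p).2 hw.2.2.1)).2 hw

/-- The load and climb conditions allow a difference of at most two along an arc. Equality forces an
empty tail, an occupied head and a climb of exactly one, which is a possible move. -/
theorem IsGame.happy {H : SimpleGraph V} {ℓ : V → ℕ} {a : V → V → Prop}
    (h : IsGame H ℓ a) (hact : ∀ v, ¬ Active ℓ a v)
    (u v : V) (huv : a u v) :
    TokenDropping.load a v ≤ TokenDropping.load a u + 1 := by
  have hu := h.load u
  have hv := h.load v
  have hc := h.climb u v huv
  by_contra! hlt
  exact hact u ⟨v, by unfold Occ; omega, by unfold Occ; omega, huv, by omega⟩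

variable [LinearOrder V]

/-- The empty node `v` asks the least possible node `p` for its token. -/
def Requests (ℓ : V → ℕ) (a : V → V → Prop) (v p : V) : Prop :=
  Wants ℓ a v p ∧ ∀ q, Wants ℓ a v q → p ≤ q

/-- The node `p` passes its token to the least node `v` that asks for it. -/
def Grants (ℓ : V → ℕ) (a : V → V → Prop) (p v : V) : Prop :=
  Requests ℓ a v p ∧ ∀ w, Requests ℓ a w p → v ≤ w

/-- One round of the token dropping game. -/
def step (ℓ : V → ℕ) (a : V → V → Prop) (u v : V) : Prop :=
  (a u v ∧ ¬ Grants ℓ a v u) ∨ Grants ℓ a u v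

/-! ### One round of the game -/

section Step

variable {ℓ : V → ℕ} {a : V → V → Prop} {p q v w : V}

theorem Grants.wants (h : Grants ℓ a p v) : Wants ℓ a v p := h.1.1

theorem Grants.avail (h : Grants ℓ a p v) : Avail ℓ a p v := h.1.1.2.2

theorem Grants.occ (h : Grants ℓ a p v) : Occ ℓ a p := h.1.1.2.1

theorem Grants.not_occ (h : Grants ℓ a p v) : ¬ Occ ℓ a v := h.1.1.1

theorem Grants.child_unique (h : Grants ℓ a p v) (h' : Grants ℓ a p w) : v = w :=
  le_antisymm (h.2 _ h'.1) (h'.2 _ h.1)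

theorem Grants.parent_unique (h : Grants ℓ a p v) (h' : Grants ℓ a q v) : p = q :=
  le_antisymm (h.1.2 _ h'.1.1) (h'.1.2 _ h.1.1)

/-- The node that `v` asks has at least one request, so it serves someone, though perhaps not `v`.
-/
theorem Active.exists_grants [WellFoundedLT V] (h : Active ℓ a v) :
    ∃ p w, a v p ∧ Grants ℓ a p w := by
  obtain ⟨p, hp, hmin⟩ := wellFounded_lt.has_min {p | Wants ℓ a v p} h
  have hreq : Requests ℓ a v p := ⟨hp, fun q hq => not_lt.1 (hmin q hq)⟩
  obtain ⟨w, hw, hmin'⟩ := wellFounded_lt.has_min {w | Requests ℓ a w p} ⟨v, hreq⟩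
  exact ⟨p, w, hp.2.2.1, hw, fun x hx => not_lt.1 (hmin' x hx)⟩

/-- A reversed arc points down a level, so it can never carry a token again: moves only disappear.
-/
theorem Avail.of_step (h : Avail ℓ (step ℓ a) p v) : Avail ℓ a p v := by
  obtain ⟨h1 | h1, h2⟩ := h
  · exact ⟨h1.1, h2⟩
  · have := h1.avail.2
    omega

theorem Grants.not_avail_step (h : Grants ℓ a p v) : ¬ Avail ℓ (step ℓ a) p v := by
  rintro ⟨h1 | h1, h2⟩
  · exact h1.2 h
  · have := h1.avail.2
    omega

theorem step_or_step {u v : V} : (step ℓ a u v ∨ step ℓ a v u) ↔ (a u v ∨ a v u) := by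
  constructor
  · rintro ((h | h) | (h | h))
    · exact .inl h.1
    · exact .inr h.avail.1
    · exact .inr h.1
    · exact .inl h.avail.1
  · have key : ∀ u v, a u v → step ℓ a u v ∨ step ℓ a v u := fun u v h => by
      by_cases hg : Grants ℓ a v u
      · exact .inr (.inr hg)
      · exact .inl (.inl ⟨h, hg⟩)
    rintro (h | h)
    · exact key u v h
    · exact (key v u h).symm

theorem load_step_of_grants_out (hf : {u | a u v}.Finite) (h : Grants ℓ a v w) :
    load (step ℓ a) v + 1 = load a v := by
  have hs : {u | step ℓ a u v} = {u | a u v} \ {w} := by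
    ext u
    constructor
    · rintro (hu | hu)
      · exact ⟨hu.1, fun e => hu.2 (by rwa [Set.mem_singleton_iff.1 e])⟩
      · exact absurd h.occ hu.not_occ
    · exact fun hu => .inl ⟨hu.1, fun e => hu.2 (e.child_unique h)⟩
  rw [load, load, hs]
  exact Set.ncard_sdiff_singleton_add_one h.avail.1 hf

theorem load_step_of_grants_in (hf : {u | a u v}.Finite) (has : ∀ u v, a u v → ¬ a v u)
    (h : Grants ℓ a p v) : load (step ℓ a) v = load a v + 1 := by
  have hs : {u | step ℓ a u v} = insert p {u | a u v} := by
    ext u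
    constructor
    · rintro (hu | hu)
      · exact .inr hu.1
      · exact .inl (hu.parent_unique h)
    · rintro (rfl | hu)
      · exact .inr h
      · exact .inl ⟨hu, fun e => h.not_occ e.occ⟩
  rw [load, load, hs]
  exact Set.ncard_insert_of_notMem (fun hp => has _ _ h.avail.1 hp) hf

theorem sameArcs_step (hout : ∀ w, ¬ Grants ℓ a v w) (hin : ∀ p, ¬ Grants ℓ a p v) :
    SameArcs (step ℓ a) a v := by
  constructor <;> intro u <;> simp [step, hout, hin]

theorem exists_grants_in (ho : Occ ℓ (step ℓ a) v) (hn : ¬ Occ ℓ a v) :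
    ∃ p, Grants ℓ a p v := by
  by_contra! hin
  have := (sameArcs_step (fun w hw => hn hw.occ) hin).load_eq
  exact hn (by rwa [Occ, this] at ho)

theorem exists_grants_out (hn : ¬ Occ ℓ (step ℓ a) v) (ho : Occ ℓ a v) :
    ∃ w, Grants ℓ a v w := by
  by_contra! hout
  have := (sameArcs_step hout (fun p hp => hp.not_occ ho)).load_eq
  exact hn (by rwa [Occ, this])

theorem IsGame.step {H : SimpleGraph V} (hH : ∀ v, (H.neighborSet v).Finite)
    (h : IsGame H ℓ a) : IsGame H ℓ (step ℓ a) where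
  adj := by
    rintro u v (hu | hu)
    · exact h.adj _ _ hu.1
    · exact (h.adj _ _ hu.avail.1).symm
  asymm := by
    rintro u v (hu | hu) (hv | hv)
    · exact h.asymm _ _ hu.1 hv.1
    · exact hu.2 hv
    · exact hv.2 hu
    · have := hu.avail.2
      have := hv.avail.2
      omega
  load := by
    intro v
    have hf := finite_arcs h.adj (hH v)
    have hl := h.load v
    by_cases hout : ∃ w, Grants ℓ a v w
    · obtain ⟨w, hw⟩ := hout
      have h1 := load_step_of_grants_out hf hw
      have h2 : ℓ v < TokenDropping.load a v := hw.occ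
      omega
    by_cases hin : ∃ p, Grants ℓ a p v
    · obtain ⟨p, hp⟩ := hin
      have h1 := load_step_of_grants_in hf h.asymm hp
      have h2 : ¬ ℓ v < TokenDropping.load a v := hp.not_occ
      omega
    · push Not at hout hin
      rw [(sameArcs_step hout hin).load_eq]
      exact hl
  climb := by
    rintro u v (hu | hu)
    · exact h.climb _ _ hu.1
    · have := hu.avail.2
      omega

end Step

/-! ### Locality of one round -/

section Locality

variable {H : SimpleGraph V} {ℓ ℓ' : V → ℕ} {a a' : V → V → Prop}

theorem requests_congr (ha : ∀ u v, a u v → H.Adj u v) {v : V}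
    (h : AllNear H (fun u => ℓ u = ℓ' u ∧ SameArcs a a' u) 1 v) (p : V) :
    Requests ℓ a v p ↔ Requests ℓ' a' v p := by
  simp only [Requests, wants_congr ha h]

theorem grants_congr (ha : ∀ u v, a u v → H.Adj u v) {p : V}
    (h : AllNear H (fun u => ℓ u = ℓ' u ∧ SameArcs a a' u) 2 p) (v : V) :
    Grants ℓ a p v ↔ Grants ℓ' a' p v := by
  have key : ∀ w, Requests ℓ a w p ↔ Requests ℓ' a' w p := fun w => by
    constructor
    · exact fun hw => (requests_congr ha (h.2 w (ha _ _ hw.1.2.2.1).symm) p).1 hw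
    · exact fun hw => (requests_congr ha
        (h.2 w (ha _ _ ((h.1.2.1 w).2 hw.1.2.2.1)).symm) p).2 hw
  simp only [Grants, key]

/-- The radius adds up as one for a request, one more for the grant that reads it, and one more for
the grants made by neighbours. -/
theorem step_congr (ha : ∀ u v, a u v → H.Adj u v) {v : V}
    (h : AllNear H (fun u => ℓ u = ℓ' u ∧ SameArcs a a' u) 3 v) :
    SameArcs (step ℓ a) (step ℓ' a') v := by
  have hout := grants_congr ha h.pred
  have hin : ∀ p, Grants ℓ a p v ↔ Grants ℓ' a' p v := fun p => by
    constructor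
    · exact fun hp => (grants_congr ha (h.2 p (ha _ _ hp.avail.1)) v).1 hp
    · exact fun hp => (grants_congr ha
        (h.2 p (ha _ _ ((h.1.2.2 p).2 hp.avail.1))) v).2 hp
  have hv := h.1.2
  constructor <;> intro u <;> simp only [step, hout, hin, hv.1 u, hv.2 u]

end Locality

/-! ### Running time of the game -/

section Run

variable {H : SimpleGraph V} {ℓ : V → ℕ} {a : ℕ → V → V → Prop} {d : ℕ}

theorem Avail.antitone (ha : ∀ t, a (t + 1) = step ℓ (a t)) {s t : ℕ} (hst : s ≤ t) {p v : V}
    (h : Avail ℓ (a t) p v) : Avail ℓ (a s) p v := by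
  induction hst with
  | refl => exact h
  | step _ ih =>
    rw [ha] at h
    exact ih h.of_step

theorem grants_time_unique (ha : ∀ t, a (t + 1) = step ℓ (a t)) {s t : ℕ} {p v : V}
    (hs : Grants ℓ (a s) p v) (ht : Grants ℓ (a t) p v) : s = t := by
  have key : ∀ s t, Grants ℓ (a s) p v → Grants ℓ (a t) p v → ¬ s < t := fun s t hs ht hlt =>
    hs.not_avail_step (ha s ▸ ht.avail.antitone ha hlt)
  exact le_antisymm (not_lt.1 (key _ _ ht hs)) (not_lt.1 (key _ _ hs ht))

open Classical in
/-- A node is active in at most `d ^ 2` rounds, since in each of them one of its parents uses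
up an arc. -/
theorem card_active_le [WellFoundedLT V] (hg : ∀ t, IsGame H ℓ (a t))
    (ha : ∀ t, a (t + 1) = step ℓ (a t)) {v : V} (hv : AllNear H (DegLE H d) 1 v) (n : ℕ) :
    ((Finset.range n).filter fun s => Active ℓ (a s) v).card ≤ d * d := by
  have hfin : ∀ u, H.Adj v u → DegLE H d u := fun u e => hv.2 u e
  have hdeg : (H.neighborSet v).Finite ∧ (H.neighborSet v).ncard ≤ d := hv.1
  -- Pairs of a possible parent of `v` and a neighbour of that parent; each active round is charged
  -- to the pair of a grant, and no pair grants twice.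
  let N : Finset (V × V) := hdeg.1.toFinset.attach.biUnion fun u =>
    (hfin u.1 (hdeg.1.mem_toFinset.1 u.2)).1.toFinset.image fun w => (u.1, w)
  have hN : N.card ≤ d * d := by
    refine (Finset.card_biUnion_le_card_mul _ _ d fun u _ => ?_).trans ?_
    · have := hfin u.1 (hdeg.1.mem_toFinset.1 u.2)
      exact Finset.card_image_le.trans (by
        rw [← Set.ncard_eq_toFinset_card _ this.1]; exact this.2)
    · rw [Finset.card_attach, ← Set.ncard_eq_toFinset_card _ hdeg.1]
      exact Nat.mul_le_mul_right _ hdeg.2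
  refine le_trans ?_ hN
  have hex : ∀ s, ∃ e : V × V, Active ℓ (a s) v → a s v e.1 ∧ Grants ℓ (a s) e.1 e.2 := fun s => by
    by_cases h : Active ℓ (a s) v
    · obtain ⟨p, w, h1, h2⟩ := h.exists_grants
      exact ⟨(p, w), fun _ => ⟨h1, h2⟩⟩
    · exact ⟨(v, v), fun h' => absurd h' h⟩
  choose f hf using hex
  refine Finset.card_le_card_of_injOn f (fun s hs => ?_) fun s hs t ht hst => ?_
  · obtain ⟨h1, h2⟩ := hf s (Finset.mem_filter.1 hs).2
    refine Finset.mem_biUnion.2 ⟨⟨(f s).1, by simpa using (hg s).adj _ _ h1⟩,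
      Finset.mem_attach _ _, ?_⟩
    exact Finset.mem_image.2 ⟨(f s).2, by simpa using ((hg s).adj _ _ h2.avail.1).symm, rfl⟩
  · have h1 := (hf s (Finset.mem_filter.1 hs).2).2
    have h2 := (hf t (Finset.mem_filter.1 ht).2).2
    rw [← hst] at h2
    exact grants_time_unique ha h1 h2

/-- If `v` is empty at time `t`, then at each earlier time `v` was empty or one of few nodes
below `v` was active. -/
theorem exists_active_below (hg : ∀ t, IsGame H ℓ (a t)) (ha : ∀ t, a (t + 1) = step ℓ (a t))
    (t : ℕ) : ∀ v, AllNear H (DegLE H d) (ℓ v + 1) v → ¬ Occ ℓ (a t) v →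
      ∃ S : Finset V, S.card ≤ ℓ v ∧ (∀ w ∈ S, AllNear H (DegLE H d) 1 w) ∧
        ∀ s ≤ t, ¬ Occ ℓ (a s) v ∨ ∃ w ∈ S, Active ℓ (a s) w := by
  classical
  induction t with
  | zero =>
    intro v _ hv
    refine ⟨∅, by simp, by simp, fun s hs => .inl ?_⟩
    rwa [Nat.le_zero.1 hs]
  | succ t ih =>
    intro v hd hv
    by_cases ho : Occ ℓ (a t) v
    · obtain ⟨w, hw⟩ := exists_grants_out (ha t ▸ hv) ho
      have hlev := hw.avail.2
      have hadj : H.Adj v w := ((hg t).adj _ _ hw.avail.1).symm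
      have hdw : AllNear H (DegLE H d) (ℓ w + 1) w := by
        rw [← hlev]; exact hd.adj hadj
      obtain ⟨S, hS, hSd, hSa⟩ := ih w hdw hw.not_occ
      refine ⟨insert w S, (Finset.card_insert_le _ _).trans (by omega), ?_, fun s hs => ?_⟩
      · intro x hx
        rcases Finset.mem_insert.1 hx with rfl | hx
        · exact hdw.mono (by omega)
        · exact hSd x hx
      · by_cases hvs : Occ ℓ (a s) v
        · have hst : s ≤ t := by
            by_contra hlt
            have : s = t + 1 := by omega
            exact hv (this ▸ hvs)
          right
          rcases hSa s hst with h | ⟨x, hx, hxa⟩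
          -- The arc used later by the token of `v` was already available at time `s`, so `w`, empty
          -- then, could have taken it.
          · exact ⟨w, Finset.mem_insert_self _ _, v, h, hvs, hw.avail.antitone ha hst⟩
          · exact ⟨x, Finset.mem_insert_of_mem hx, hxa⟩
        · exact .inl hvs
    · obtain ⟨S, hS, hSd, hSa⟩ := ih v hd ho
      refine ⟨S, hS, hSd, fun s hs => ?_⟩
      rcases Nat.le_succ_iff.1 hs with hs | rfl
      · exact hSa s hs
      · exact .inl hv

/-- If `p` holds a token at time `t`, then at each earlier time `p` held a token or one of few
nodes above or at `p` was active. -/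
theorem exists_active_above (hg : ∀ t, IsGame H ℓ (a t)) (ha : ∀ t, a (t + 1) = step ℓ (a t))
    (t : ℕ) : ∀ p, AllNear H (DegLE H d) (d - ℓ p + 1) p → Occ ℓ (a t) p →
      ∃ S : Finset V, S.card ≤ d - ℓ p ∧ (∀ w ∈ S, AllNear H (DegLE H d) 1 w) ∧
        ∀ s ≤ t, Occ ℓ (a s) p ∨ ∃ w ∈ S, Active ℓ (a s) w := by
  classical
  induction t with
  | zero =>
    intro v _ hv
    refine ⟨∅, by simp, by simp, fun s hs => .inl ?_⟩
    rwa [Nat.le_zero.1 hs]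
  | succ t ih =>
    intro p hd hp
    by_cases ho : Occ ℓ (a t) p
    · obtain ⟨S, hS, hSd, hSa⟩ := ih p hd ho
      refine ⟨S, hS, hSd, fun s hs => ?_⟩
      rcases Nat.le_succ_iff.1 hs with hs | rfl
      · exact hSa s hs
      · exact .inl hp
    -- The token came from one level up. Levels stay below the degree bound, so its trail climbs at
    -- most `d - ℓ p` times.
    · obtain ⟨q, hq⟩ := exists_grants_in (ha t ▸ hp) ho
      have hlev := hq.avail.2
      have hadj : H.Adj p q := (hg t).adj _ _ hq.avail.1
      have hqd : ℓ q ≤ d := (hg 0).level_le (hd.adj hadj).self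
      have hdq : AllNear H (DegLE H d) (d - ℓ q + 1) q := (hd.adj hadj).mono (by omega)
      obtain ⟨S, hS, hSd, hSa⟩ := ih q hdq hq.occ
      refine ⟨insert p S, (Finset.card_insert_le _ _).trans (by omega), ?_, fun s hs => ?_⟩
      · intro x hx
        rcases Finset.mem_insert.1 hx with rfl | hx
        · exact hd.mono (by omega)
        · exact hSd x hx
      · by_cases hps : Occ ℓ (a s) p
        · exact .inl hps
        · have hst : s ≤ t := by
            by_contra hlt
            have : s = t + 1 := by omega
            exact hps (this ▸ hp)
          right
          rcases hSa s hst with h | ⟨x, hx, hxa⟩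
          · exact ⟨p, Finset.mem_insert_self _ _, q, hps, h, hq.avail.antitone ha hst⟩
          · exact ⟨x, Finset.mem_insert_of_mem hx, hxa⟩

/-- At each time up to `t`, either some node on the two trails is active, or `p` is occupied and `v`
empty, and then `v` itself is active. Counting active rounds over these nodes bounds `t + 1`. -/
theorem Active.time_lt [WellFoundedLT V] (hg : ∀ t, IsGame H ℓ (a t))
    (ha : ∀ t, a (t + 1) = step ℓ (a t)) {v : V} (hd : AllNear H (DegLE H d) (d + 2) v) {t : ℕ}
    (h : Active ℓ (a t) v) : t < d ^ 3 := by
  classical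
  obtain ⟨p, hv, hp, hpv⟩ := h
  have hadj : H.Adj v p := (hg t).adj _ _ hpv.1
  have hlev := hpv.2
  have hlp : ℓ p ≤ d := (hg 0).level_le (hd.adj hadj).self
  obtain ⟨S, hS, hSd, hSa⟩ := exists_active_above hg ha t p ((hd.adj hadj).mono (by omega)) hp
  obtain ⟨R, hR, hRd, hRa⟩ := exists_active_below hg ha t v (hd.mono (by omega)) hv
  let U := insert v (S ∪ R)
  -- Since `ℓ p = ℓ v + 1`, the count is `1 + (d - ℓ p) + ℓ v = d`.
  have hU : U.card ≤ d := by
    have h1 := Finset.card_insert_le v (S ∪ R)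
    have h2 := Finset.card_union_le S R
    change (insert v (S ∪ R)).card ≤ d
    omega
  have hUd : ∀ w ∈ U, AllNear H (DegLE H d) 1 w := by
    intro w hw
    rcases Finset.mem_insert.1 hw with rfl | hw
    · exact hd.mono (by omega)
    · rcases Finset.mem_union.1 hw with hw | hw
      · exact hSd w hw
      · exact hRd w hw
  have hcover : Finset.range (t + 1) ⊆
      U.biUnion fun w => (Finset.range (t + 1)).filter fun s => Active ℓ (a s) w := by
    intro s hs
    have hst : s ≤ t := Nat.lt_succ_iff.1 (Finset.mem_range.1 hs)
    suffices ∃ w ∈ U, Active ℓ (a s) w by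
      obtain ⟨w, hw, hwa⟩ := this
      exact Finset.mem_biUnion.2 ⟨w, hw, Finset.mem_filter.2 ⟨hs, hwa⟩⟩
    rcases hSa s hst with h1 | ⟨w, hw, hwa⟩
    · rcases hRa s hst with h2 | ⟨w, hw, hwa⟩
      · exact ⟨v, Finset.mem_insert_self _ _, p, h2, h1, hpv.antitone ha hst⟩
      · exact ⟨w, Finset.mem_insert_of_mem (Finset.mem_union_right _ hw), hwa⟩
    · exact ⟨w, Finset.mem_insert_of_mem (Finset.mem_union_left _ hw), hwa⟩
  have h1 := Finset.card_le_card hcover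
  rw [Finset.card_range] at h1
  have h2 := Finset.card_biUnion_le_card_mul U
    (fun w => (Finset.range (t + 1)).filter fun s => Active ℓ (a s) w) (d * d)
    fun w hw => card_active_le hg ha (hUd w hw) _
  have h3 : U.card * (d * d) ≤ d * (d * d) := Nat.mul_le_mul_right _ hU
  have h4 : d ^ 3 = d * (d * d) := by ring
  omega

/-- Every change at `v` is a grant whose receiver, `v` or a neighbour, is active. Only degrees near
`v` enter, so distant parts of the graph may still be moving tokens. -/
theorem sameArcs_of_ge [WellFoundedLT V] (hg : ∀ t, IsGame H ℓ (a t))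
    (ha : ∀ t, a (t + 1) = step ℓ (a t)) {v : V} (hd : AllNear H (DegLE H d) (d + 3) v) {t : ℕ}
    (ht : d ^ 3 ≤ t) : SameArcs (a t) (a (d ^ 3)) v := by
  induction ht with
  | refl => exact .refl _ _
  | step ht ih =>
    rename_i m
    rw [Nat.succ_eq_add_one, ha]
    refine (sameArcs_step (fun w hw => ?_) fun p hp => ?_).trans ih
    · have hadj : H.Adj v w := ((hg m).adj _ _ hw.avail.1).symm
      have := Active.time_lt hg ha (hd.adj hadj) ⟨v, hw.wants⟩
      exact absurd ht (by simpa using this)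
    · have := Active.time_lt hg ha (v := v) (hd.mono (by omega)) ⟨p, hp.wants⟩
      exact absurd ht (by simpa using this)

/-- No token reaches a node whose surroundings start without tokens. -/
theorem not_occ_of_near (hg : ∀ t, IsGame H ℓ (a t)) (ha : ∀ t, a (t + 1) = step ℓ (a t))
    (t : ℕ) : ∀ p, AllNear H (fun u => DegLE H d u ∧ ¬ Occ ℓ (a 0) u) (d - ℓ p + 1) p →
      ¬ Occ ℓ (a t) p := by
  induction t with
  | zero => exact fun p hp => hp.self.2
  | succ t ih =>
    intro p hp ho
    obtain ⟨q, hq⟩ := exists_grants_in (ha t ▸ ho) (ih p hp)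
    have hlev := hq.avail.2
    have hadj : H.Adj p q := (hg t).adj _ _ hq.avail.1
    have hqd : ℓ q ≤ d := (hg 0).level_le (hp.adj hadj).self.1
    exact ih q ((hp.adj hadj).mono (by omega)) hq.occ

/-- The arcs at a node whose surroundings start without tokens never change. -/
theorem sameArcs_zero_of_near (hg : ∀ t, IsGame H ℓ (a t))
    (ha : ∀ t, a (t + 1) = step ℓ (a t)) {v : V}
    (hv : AllNear H (fun u => DegLE H d u ∧ ¬ Occ ℓ (a 0) u) (d + 2) v) (t : ℕ) :
    SameArcs (a t) (a 0) v := by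
  induction t with
  | zero => exact .refl _ _
  | succ t ih =>
    rw [ha]
    refine (sameArcs_step (fun w hw => ?_) fun p hp => ?_).trans ih
    · exact not_occ_of_near hg ha t v (hv.mono (by omega)) hw.occ
    · have hadj : H.Adj v p := (hg t).adj _ _ hp.avail.1
      exact not_occ_of_near hg ha t p ((hv.adj hadj).mono (by omega)) hp.occ

end Run

end TokenDropping

/-! ### Phases: accepting edges and dropping the tokens -/

namespace TokenDropping

variable {V : Type*}

/-- The edge between `u` and `v` has not been oriented yet. -/
def Unoriented (H : SimpleGraph V) (a : V → V → Prop) (u v : V) : Prop :=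
  H.Adj u v ∧ ¬ a u v ∧ ¬ a v u

theorem Unoriented.symm {H : SimpleGraph V} {a : V → V → Prop} {u v : V}
    (h : Unoriented H a u v) : Unoriented H a v u :=
  ⟨h.1.symm, h.2.2, h.2.1⟩

theorem unoriented_congr {H H' : SimpleGraph V} {a a' : V → V → Prop} {v : V}
    (h : SameNbrs H H' v ∧ SameArcs a a' v) (u : V) :
    Unoriented H a u v ↔ Unoriented H' a' u v := by
  simp only [Unoriented, H.adj_comm u v, H'.adj_comm u v, h.1 u, h.2.1 u, h.2.2 u]

variable [LinearOrder V]

/-- An unoriented edge proposes to its endpoint of lower load, ties being broken by the order. -/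
def Proposes (H : SimpleGraph V) (a : V → V → Prop) (u v : V) : Prop :=
  Unoriented H a u v ∧ (load a v < load a u ∨ load a v = load a u ∧ v < u)

/-- A node accepts the proposal of the edge to its least possible neighbour. -/
def Accepts (H : SimpleGraph V) (a : V → V → Prop) (u v : V) : Prop :=
  Proposes H a u v ∧ ∀ w, Proposes H a w v → u ≤ w

/-- The arcs after the accepted edges have been oriented. -/
def start (H : SimpleGraph V) (a : V → V → Prop) (u v : V) : Prop := a u v ∨ Accepts H a u v

/-- The arcs after `t` rounds of the token dropping game of a phase that begins with `a`. -/
def game (H : SimpleGraph V) (a : V → V → Prop) (t : ℕ) : V → V → Prop :=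
  (step (load a))^[t] (start H a)

/-- The arcs at the end of a phase that begins with `a`. -/
def phase (H : SimpleGraph V) (a : V → V → Prop) (u v : V) : Prop :=
  ∀ᶠ t in Filter.atTop, game H a t u v

/-- The arcs after `k` phases. -/
def phases (H : SimpleGraph V) (k : ℕ) : V → V → Prop := (phase H)^[k] fun _ _ => False

/-- The arcs that are present from some phase on. -/
def limit (H : SimpleGraph V) (u v : V) : Prop := ∀ᶠ k in Filter.atTop, phases H k u v

variable {H : SimpleGraph V} {a : V → V → Prop} {d B : ℕ}

theorem game_succ (t : ℕ) : game H a (t + 1) = step (load a) (game H a t) :=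
  Function.iterate_succ_apply' _ _ _

theorem phases_succ (k : ℕ) : phases H (k + 1) = phase H (phases H k) :=
  Function.iterate_succ_apply' _ _ _

theorem Accepts.unique {u v w : V} (h : Accepts H a u v) (h' : Accepts H a w v) : u = w :=
  le_antisymm (h.2 _ h'.1) (h'.2 _ h.1)

theorem Proposes.asymm {u v : V} (h : Proposes H a u v) : ¬ Proposes H a v u := by
  rintro ⟨_, h2 | h2⟩ <;> obtain ⟨_, h1 | h1⟩ := h
  · omega
  · omega
  · omega
  · exact lt_asymm h1.2 h2.2

theorem load_start_of_accepts {u v : V} (hf : {u | a u v}.Finite) (h : Accepts H a u v) :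
    load (start H a) v = load a v + 1 := by
  have hs : {w | start H a w v} = insert u {w | a w v} := by
    ext w
    constructor
    · rintro (hw | hw)
      · exact .inr hw
      · exact .inl (hw.unique h)
    · rintro (rfl | hw)
      · exact .inr h
      · exact .inl hw
  rw [load, load, hs]
  exact Set.ncard_insert_of_notMem h.1.1.2.1 hf

theorem load_start_of_not_accepts {v : V} (h : ∀ u, ¬ Accepts H a u v) :
    load (start H a) v = load a v := by
  simp [load, start, h]

/-- Old arcs climb by at most one because they were happy, and accepted arcs do not climb at all. -/
theorem IsPartial.isGame_start (hH : ∀ v, (H.neighborSet v).Finite) (h : IsPartial H a) :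
    IsGame H (load a) (start H a) where
  adj := by
    rintro u v (hu | hu)
    · exact h.adj _ _ hu
    · exact hu.1.1.1
  asymm := by
    rintro u v (hu | hu) (hv | hv)
    · exact h.asymm _ _ hu hv
    · exact hv.1.1.2.2 hu
    · exact hu.1.1.2.2 hv
    · exact hu.1.asymm hv.1
  load := by
    intro v
    by_cases hv : ∃ u, Accepts H a u v
    · obtain ⟨u, hu⟩ := hv
      exact .inr (load_start_of_accepts (finite_arcs h.adj (hH v)) hu)
    · exact .inl (load_start_of_not_accepts (not_exists.1 hv))
  climb := by
    rintro u v (hu | hu)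
    · exact h.happy _ _ hu
    · have := hu.1.2
      omega

theorem IsPartial.isGame_game (hH : ∀ v, (H.neighborSet v).Finite) (h : IsPartial H a) (t : ℕ) :
    IsGame H (load a) (game H a t) := by
  induction t with
  | zero => exact h.isGame_start hH
  | succ t ih => rw [game_succ]; exact ih.step hH

theorem sameArcs_phase {v : V} {T : ℕ}
    (h : ∀ t, T ≤ t → SameArcs (game H a t) (game H a T) v) :
    SameArcs (phase H a) (game H a T) v := by
  constructor <;> intro u
  · exact (Filter.eventually_congr (Filter.eventually_atTop.2
      ⟨T, fun t ht => (h t ht).1 u⟩)).trans Filter.eventually_const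
  · exact (Filter.eventually_congr (Filter.eventually_atTop.2
      ⟨T, fun t ht => (h t ht).2 u⟩)).trans Filter.eventually_const

theorem sameArcs_limit {v : V} {K : ℕ}
    (h : ∀ k, K ≤ k → SameArcs (phases H k) (phases H K) v) :
    SameArcs (limit H) (phases H K) v := by
  constructor <;> intro u
  · exact (Filter.eventually_congr (Filter.eventually_atTop.2
      ⟨K, fun k hk => (h k hk).1 u⟩)).trans Filter.eventually_const
  · exact (Filter.eventually_congr (Filter.eventually_atTop.2
      ⟨K, fun k hk => (h k hk).2 u⟩)).trans Filter.eventually_const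

theorem unoriented_game (t : ℕ) {u v : V} :
    Unoriented H (game H a t) u v ↔ Unoriented H (start H a) u v := by
  induction t with
  | zero => rfl
  | succ t ih =>
    rw [← ih, game_succ, Unoriented, Unoriented, ← not_or, ← not_or, step_or_step]

theorem Unoriented.of_start {u v : V} (h : Unoriented H (start H a) u v) : Unoriented H a u v :=
  ⟨h.1, fun h' => h.2.1 (.inl h'), fun h' => h.2.2 (.inl h')⟩

theorem ncard_unoriented_start_le {v : V} (hv : (H.neighborSet v).Finite) :
    {u | Unoriented H (start H a) v u}.ncard ≤ {u | Unoriented H a v u}.ncard :=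
  Set.ncard_le_ncard (fun _ h => h.of_start) (hv.subset fun _ h => h.1)

theorem ncard_unoriented_start_lt {v w : V} (hv : (H.neighborSet v).Finite)
    (hw : Accepts H a w v) :
    {u | Unoriented H (start H a) v u}.ncard < {u | Unoriented H a v u}.ncard :=
  Set.ncard_lt_ncard ⟨fun _ h => h.of_start, fun hsub => (hsub hw.1.1.symm).2.2 (.inr hw)⟩
    (hv.subset fun _ h => h.1)

/-! ### Locality of a phase -/

section Locality

variable {H' : SimpleGraph V} {a' : V → V → Prop}

theorem proposes_congr {v : V} (h : AllNear H (fun u => SameNbrs H H' u ∧ SameArcs a a' u) 1 v)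
    (u : V) : Proposes H a u v ↔ Proposes H' a' u v := by
  by_cases e : H.Adj v u
  · simp only [Proposes, unoriented_congr h.1, h.1.2.load_eq, (h.2 u e).2.load_eq]
  · exact ⟨fun hp => absurd hp.1.1.symm e,
      fun hp => absurd ((unoriented_congr h.1 u).2 hp.1).1.symm e⟩

theorem accepts_congr {v : V} (h : AllNear H (fun u => SameNbrs H H' u ∧ SameArcs a a' u) 1 v)
    (u : V) : Accepts H a u v ↔ Accepts H' a' u v := by
  simp only [Accepts, proposes_congr h]

theorem start_congr {v : V} (h : AllNear H (fun u => SameNbrs H H' u ∧ SameArcs a a' u) 2 v) :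
    SameArcs (start H a) (start H' a') v := by
  have hv := h.1
  constructor <;> intro u
  · simp only [start, hv.2.1 u, accepts_congr h.pred]
  · by_cases e : H.Adj v u
    · simp only [start, hv.2.2 u, accepts_congr (h.2 u e)]
    · have e' : ¬ H'.Adj v u := fun h' => e ((hv.1 u).2 h')
      have h1 : ¬ Accepts H a v u := fun h' => e h'.1.1.1
      have h2 : ¬ Accepts H' a' v u := fun h' => e' h'.1.1.1
      simp only [start, hv.2.2 u, h1, h2]

theorem game_congr (hH : ∀ v, (H.neighborSet v).Finite) (ha : IsPartial H a) (t : ℕ) :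
    ∀ v, AllNear H (fun u => SameNbrs H H' u ∧ SameArcs a a' u) (3 * t + 2) v →
      SameArcs (game H a t) (game H' a' t) v := by
  induction t with
  | zero => exact fun v h => start_congr h
  | succ t ih =>
    intro v h
    rw [game_succ, game_succ]
    have h' := AllNear.nest (m := 3) (n := 3 * t + 2) (h.mono (by omega))
    exact step_congr (ha.isGame_game hH t).adj
      (h'.imp fun u hu => ⟨hu.self.2.load_eq, ih u hu⟩)

end Locality

/-! ### Number of phases and stabilisation -/

section Phase

variable [WellFoundedLT V]

theorem IsPartial.sameArcs_phase (hH : ∀ v, (H.neighborSet v).Finite) (ha : IsPartial H a)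
    {v : V} (hv : AllNear H (DegLE H d) (d + 3) v) :
    SameArcs (phase H a) (game H a (d ^ 3)) v :=
  TokenDropping.sameArcs_phase fun _ ht => sameArcs_of_ge (ha.isGame_game hH) game_succ hv ht

theorem IsPartial.phase_eq (hB : ∀ v, DegLE H B v) (ha : IsPartial H a) :
    phase H a = game H a (B ^ 3) := by
  funext u v
  exact propext ((ha.sameArcs_phase (fun v => (hB v).1) (AllNear.of_forall hB _ v)).1 u)

theorem IsPartial.phase (hB : ∀ v, DegLE H B v) (ha : IsPartial H a) :
    IsPartial H (phase H a) := by
  have hg := ha.isGame_game fun v => (hB v).1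
  rw [ha.phase_eq hB]
  refine ⟨(hg _).adj, (hg _).asymm, (hg _).happy fun v hv => ?_⟩
  exact lt_irrefl _ (Active.time_lt hg game_succ (AllNear.of_forall hB _ v) hv)

theorem isPartial_phases (hB : ∀ v, DegLE H B v) (k : ℕ) : IsPartial H (phases H k) := by
  induction k with
  | zero => exact ⟨fun _ _ h => h.elim, fun _ _ h => h.elim, fun _ _ h => h.elim⟩
  | succ k ih => rw [phases_succ]; exact ih.phase hB

/-- Both phases have settled at `v` after `d ^ 3` rounds. The radius is the sum of `3 * d ^ 3 + 2`
for simulating these rounds and `d + 3` for the settling. The global bounds `B` and `B'` do not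
affect it. -/
theorem phase_congr {H' : SimpleGraph V} {a' : V → V → Prop} {B' : ℕ}
    (hB : ∀ v, DegLE H B v) (hB' : ∀ v, DegLE H' B' v) (ha : IsPartial H a)
    (ha' : IsPartial H' a') {v : V}
    (h : AllNear H (fun u => (SameNbrs H H' u ∧ DegLE H d u) ∧ SameArcs a a' u)
      (3 * d ^ 3 + d + 5) v) : SameArcs (phase H a) (phase H' a') v := by
  have h1 : AllNear H (DegLE H d) (d + 3) v := (h.mono (by omega)).imp fun u hu => hu.1.2
  have h2 : AllNear H' (DegLE H' d) (d + 3) v :=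
    AllNear.transfer ((h.mono (by omega)).imp fun u hu => ⟨hu.1.1, hu.1.2.congr hu.1.1⟩)
  have h3 := game_congr (fun v => (hB v).1) ha (d ^ 3) v
    ((h.mono (by omega)).imp fun u hu => ⟨hu.1.1, hu.2⟩)
  exact ((ha.sameArcs_phase (fun v => (hB v).1) h1).trans h3).trans
    (ha'.sameArcs_phase (fun v => (hB' v).1) h2).symm

theorem phases_congr {H' : SimpleGraph V} {B' : ℕ} (hB : ∀ v, DegLE H B v)
    (hB' : ∀ v, DegLE H' B' v) (k : ℕ) : ∀ v,
    AllNear H (fun u => SameNbrs H H' u ∧ DegLE H d u) (k * (3 * d ^ 3 + d + 5)) v →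
      SameArcs (phases H k) (phases H' k) v := by
  induction k with
  | zero => exact fun v _ => .refl _ _
  | succ k ih =>
    intro v h
    rw [phases_succ, phases_succ]
    rw [Nat.succ_mul, Nat.add_comm] at h
    exact phase_congr hB hB' (isPartial_phases hB k) (isPartial_phases hB' k)
      (h.nest.imp fun u hu => ⟨hu.self, ih u hu⟩)

theorem IsPartial.unoriented_phase (hB : ∀ v, DegLE H B v) (ha : IsPartial H a) {u v : V} :
    Unoriented H (TokenDropping.phase H a) u v ↔ Unoriented H (start H a) u v := by
  rw [ha.phase_eq hB, unoriented_game]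

theorem Unoriented.exists_accepts {u v : V} (h : Unoriented H a u v) :
    (∃ w, Accepts H a w u) ∨ ∃ w, Accepts H a w v := by
  have key : ∀ u v, Proposes H a u v → ∃ w, Accepts H a w v := fun u v h => by
    obtain ⟨w, hw, hmin⟩ := wellFounded_lt.has_min {w | Proposes H a w v} ⟨u, h⟩
    exact ⟨w, hw, fun x hx => not_lt.1 (hmin x hx)⟩
  rcases lt_trichotomy (load a u) (load a v) with hl | hl | hl
  · exact .inl (key v u ⟨h.symm, .inl hl⟩)
  · rcases lt_or_gt_of_ne h.1.ne with hlt | hlt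
    · exact .inl (key v u ⟨h.symm, .inr ⟨hl, hlt⟩⟩)
    · exact .inr (key u v ⟨h, .inr ⟨hl.symm, hlt⟩⟩)
  · exact .inr (key u v ⟨h, .inl hl⟩)

/-- As long as an edge is unoriented, one of its endpoints accepts an edge in each phase. -/
theorem Unoriented.phases_add_le (hB : ∀ v, DegLE H B v) (k : ℕ) {u v : V}
    (h : Unoriented H (phases H k) u v) :
    {w | Unoriented H (phases H k) u w}.ncard + {w | Unoriented H (phases H k) v w}.ncard + k ≤
      (H.neighborSet u).ncard + (H.neighborSet v).ncard := by
  induction k with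
  | zero =>
    have hu : {w | Unoriented H (phases H 0) u w}.ncard ≤ (H.neighborSet u).ncard :=
      Set.ncard_le_ncard (fun _ h => h.1) (hB u).1
    have hv : {w | Unoriented H (phases H 0) v w}.ncard ≤ (H.neighborSet v).ncard :=
      Set.ncard_le_ncard (fun _ h => h.1) (hB v).1
    omega
  | succ k ih =>
    simp only [phases_succ, (isPartial_phases hB k).unoriented_phase hB] at h ⊢
    have h1 := ih h.of_start
    have h2 := ncard_unoriented_start_le (a := phases H k) (hB u).1
    have h3 := ncard_unoriented_start_le (a := phases H k) (hB v).1
    rcases h.of_start.exists_accepts with ⟨w, hw⟩ | ⟨w, hw⟩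
    · have := ncard_unoriented_start_lt (hB u).1 hw
      omega
    · have := ncard_unoriented_start_lt (hB v).1 hw
      omega

theorem not_unoriented_phases (hB : ∀ v, DegLE H B v) {k : ℕ} {u v : V} (hu : DegLE H d u)
    (hv : DegLE H d v) (hk : 2 * d ≤ k) : ¬ Unoriented H (phases H k) u v := by
  intro h
  have h1 := h.phases_add_le hB
  have h2 : 0 < {w | Unoriented H (phases H k) u w}.ncard :=
    (Set.ncard_pos ((hB u).1.subset fun _ h => h.1)).2 ⟨v, h⟩
  have := hu.2
  have := hv.2
  omega

/-- Near `v` no edge is left to accept, so no tokens arise there. Tokens only descend and nearby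
levels are at most `d`, so none arrives from regions that are still unfinished. -/
theorem sameArcs_phases (hB : ∀ v, DegLE H B v) {v : V}
    (hv : AllNear H (DegLE H d) (d + 3) v) {k : ℕ} (hk : 2 * d ≤ k) :
    SameArcs (phases H k) (phases H (2 * d)) v := by
  induction hk with
  | refl => exact .refl _ _
  | step hk ih =>
    rename_i m
    have hm := isPartial_phases hB m
    have hno : ∀ u, AllNear H (DegLE H d) 1 u → ∀ w, ¬ Unoriented H (phases H m) u w :=
      fun u hu w hw => not_unoriented_phases hB hu.1 (hu.2 w hw.1) hk hw
    have hnear : AllNear H (fun u => DegLE H d u ∧ ¬ Occ (load (phases H m))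
        (game H (phases H m) 0) u) (d + 2) v := by
      refine (AllNear.nest (n := 1) hv).imp fun u hu => ⟨hu.1, fun ho => ?_⟩
      refine absurd ho (not_lt.2 (le_of_eq (load_start_of_not_accepts fun w hw => ?_)))
      exact hno u hu w hw.1.1.symm
    rw [Nat.succ_eq_add_one, phases_succ, hm.phase_eq hB]
    refine ((sameArcs_zero_of_near (hm.isGame_game fun v => (hB v).1) game_succ hnear _).trans
      ?_).trans ih
    have hv1 : AllNear H (DegLE H d) 1 v := hv.mono (by omega)
    constructor <;> intro w
    · exact or_iff_left fun hw => hno v hv1 w hw.1.1.symm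
    · exact or_iff_left fun hw => hno v hv1 w hw.1.1

theorem limit_eq (hB : ∀ v, DegLE H B v) : limit H = phases H (2 * B) := by
  funext u v
  exact propext ((sameArcs_limit fun _ hk =>
    sameArcs_phases hB (AllNear.of_forall hB _ v) hk).1 u)

theorem isPartial_limit (hB : ∀ v, DegLE H B v) : IsPartial H (limit H) := by
  rw [limit_eq hB]
  exact isPartial_phases hB _

theorem limit_or_limit (hB : ∀ v, DegLE H B v) {u v : V} (h : H.Adj u v) :
    limit H u v ∨ limit H v u := by
  have := not_unoriented_phases hB (hB u) (hB v) le_rfl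
  rw [limit_eq hB]
  by_contra! hn
  exact this ⟨h, hn⟩

/-- The orientation at a node depends only on its surroundings, up to a distance that is
polynomial in the maximum degree. -/
theorem limit_congr {H' : SimpleGraph V} {B' : ℕ} (hB : ∀ v, DegLE H B v)
    (hB' : ∀ v, DegLE H' B' v) {v : V}
    (h : AllNear H (fun u => SameNbrs H H' u ∧ DegLE H d u) (18 * d ^ 4) v) :
    SameArcs (limit H) (limit H') v := by
  -- For `d = 0` the radius is zero, too small for the settling lemmas, but `v` is isolated.
  rcases Nat.eq_zero_or_pos d with rfl | hd
  · have h0 : ∀ u, ¬ H.Adj v u := fun u e => by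
      have h1 := Set.ncard_pos (h.self.2.1) |>.2 ⟨u, e⟩
      have h2 := h.self.2.2
      omega
    have h0' : ∀ u, ¬ H'.Adj v u := fun u e => h0 u ((h.self.1 u).2 e)
    have hp := (isPartial_limit hB).adj
    have hp' := (isPartial_limit hB').adj
    constructor <;> intro u
    · exact iff_of_false (fun e => h0 u (hp _ _ e).symm) fun e => h0' u (hp' _ _ e).symm
    · exact iff_of_false (fun e => h0 u (hp _ _ e)) fun e => h0' u (hp' _ _ e)
  -- The constant 18 is `6 + 2 + 10`, with the lower powers of `d` replaced by `d ^ 4`.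
  have e1 : d ≤ d ^ 4 := Nat.le_self_pow (by omega) d
  have e2 : d ^ 2 ≤ d ^ 4 := Nat.pow_le_pow_right hd (by omega)
  have e3 : 2 * d * (3 * d ^ 3 + d + 5) = 6 * d ^ 4 + 2 * d ^ 2 + 10 * d := by ring
  have h1 : AllNear H (DegLE H d) (d + 3) v := (h.mono (by omega)).imp fun u hu => hu.2
  have h2 : AllNear H' (DegLE H' d) (d + 3) v :=
    AllNear.transfer ((h.mono (by omega)).imp fun u hu => ⟨hu.1, hu.2.congr hu.1⟩)
  have h3 := phases_congr hB hB' (2 * d) v (h.mono (by omega))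
  exact ((sameArcs_limit fun _ hk => sameArcs_phases hB h1 hk).trans h3).trans
    (sameArcs_limit fun _ hk => sameArcs_phases hB' h2 hk).symm

end Phase

end TokenDropping

/-! ### The gathering algorithm -/

namespace LocalAlgorithm

open TokenDropping

/-- The list `K` contains the neighbourhood in `H` of every node within distance `t` of `i`. -/
def Compatible (H : SimpleGraph ℕ) (i t : ℕ) (K : Finset (ℕ × Finset ℕ)) : Prop :=
  AllNear H (fun u => ∃ S, (u, S) ∈ K ∧ ∀ w, w ∈ S ↔ H.Adj u w) t i

/-- The neighbourhoods listed in `K` force the set of in-neighbours of `i` to be `o`. -/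
def Forces (i t : ℕ) (K : Finset (ℕ × Finset ℕ)) (o : Finset ℕ) : Prop :=
  ∀ (H : SimpleGraph ℕ) (B : ℕ), (∀ v, DegLE H B v) → Compatible H i t K →
    ∀ u, u ∈ o ↔ limit H u i

open Classical in
/-- Every node gathers its surroundings until they determine the arcs that point to it.  A state
consists of the identifier, the number of rounds so far, and the known neighbourhoods. -/
noncomputable def gather : LocalAlgorithm (Finset ℕ) where
  State := ℕ × ℕ × Finset (ℕ × Finset ℕ)
  Msg := Finset (ℕ × Finset ℕ)
  init i N := (i, 0, {(i, N)})
  send s _ := s.2.2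
  recv s M := (s.1, s.2.1 + 1, s.2.2 ∪ M.biUnion Prod.snd)
  output s := if h : ∃ o, Forces s.1 s.2.1 s.2.2 o then some h.choose else none

section

variable {V : Type} [Fintype V] (G : SimpleGraph V) [DecidableRel G.Adj] (ident : V ↪ ℕ)

theorem gather_fst (t : ℕ) (v : V) : (gather.stateAt G ident t v).1 = ident v := by
  induction t with
  | zero => rfl
  | succ t ih => exact ih

theorem gather_time (t : ℕ) (v : V) : (gather.stateAt G ident t v).2.1 = t := by
  induction t with
  | zero => rfl
  | succ t ih => exact congrArg (· + 1) ih

theorem mem_gather_zero {v : V} {x : ℕ × Finset ℕ} :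
    x ∈ (gather.stateAt G ident 0 v).2.2 ↔ x = (ident v, (G.neighborFinset v).map ident) :=
  Finset.mem_singleton

theorem mem_gather_succ {t : ℕ} {v : V} {x : ℕ × Finset ℕ} :
    x ∈ (gather.stateAt G ident (t + 1) v).2.2 ↔ x ∈ (gather.stateAt G ident t v).2.2 ∨
      ∃ u, G.Adj v u ∧ x ∈ (gather.stateAt G ident t u).2.2 := by
  classical
  simp only [stateAt]
  simp [gather]

theorem mem_nbrs {v : V} {w : ℕ} :
    w ∈ (G.neighborFinset v).map ident ↔ (G.map ident).Adj (ident v) w := by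
  simp only [Finset.mem_map, SimpleGraph.mem_neighborFinset, SimpleGraph.map_adj]
  constructor
  · rintro ⟨u, h, rfl⟩
    exact ⟨v, u, h, rfl, rfl⟩
  · rintro ⟨v', u, h, hv, rfl⟩
    exact ⟨u, ident.injective hv ▸ h, rfl⟩

theorem gather_sound (t : ℕ) : ∀ (v : V) (x : ℕ × Finset ℕ),
    x ∈ (gather.stateAt G ident t v).2.2 → ∀ w, w ∈ x.2 ↔ (G.map ident).Adj x.1 w := by
  induction t with
  | zero =>
    intro v x hx w
    rw [mem_gather_zero] at hx
    subst hx
    exact mem_nbrs G ident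
  | succ t ih =>
    intro v x hx
    rcases (mem_gather_succ G ident).1 hx with hx | ⟨u, _, hx⟩
    · exact ih v x hx
    · exact ih u x hx

theorem self_mem_gather (t : ℕ) (v : V) :
    (ident v, (G.neighborFinset v).map ident) ∈ (gather.stateAt G ident t v).2.2 := by
  induction t with
  | zero => exact (mem_gather_zero G ident).2 rfl
  | succ t ih => exact (mem_gather_succ G ident).2 (.inl ih)

theorem compatible_gather (t : ℕ) : ∀ v : V,
    Compatible (G.map ident) (ident v) t (gather.stateAt G ident t v).2.2 := by
  induction t with
  | zero => exact fun v => ⟨_, self_mem_gather G ident 0 v, fun w => mem_nbrs G ident⟩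
  | succ t ih =>
    refine fun v => ⟨⟨_, self_mem_gather G ident _ v, fun w => mem_nbrs G ident⟩, fun i hi => ?_⟩
    obtain ⟨u, hu, rfl⟩ := Finset.mem_map.1 ((mem_nbrs G ident).2 hi)
    refine (ih u).imp fun x ⟨S, hS, hx⟩ => ⟨S, (mem_gather_succ G ident).2 (.inr ⟨u, ?_, hS⟩), hx⟩
    exact (G.mem_neighborFinset v u).1 hu

theorem neighborSet_map (v : V) :
    (G.map ident).neighborSet (ident v) = ((G.neighborFinset v).map ident : Finset ℕ) := by
  ext w
  exact (mem_nbrs G ident).symm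

theorem degLE_map (i : ℕ) : DegLE (G.map ident) G.maxDegree i := by
  by_cases hi : ∃ v, ident v = i
  · obtain ⟨v, rfl⟩ := hi
    rw [DegLE, neighborSet_map, Set.ncard_coe_finset, Finset.card_map]
    exact ⟨Finset.finite_toSet _, G.degree_le_maxDegree v⟩
  · have : (G.map ident).neighborSet i = ∅ := by
      ext w
      simp only [SimpleGraph.mem_neighborSet, SimpleGraph.map_adj, Set.mem_empty_iff_false,
        iff_false]
      rintro ⟨v, _, _, hv, _⟩
      exact hi ⟨v, hv⟩
    rw [DegLE, this]
    simp

theorem limit_map_finite (i : ℕ) : {u | limit (G.map ident) u i}.Finite :=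
  finite_arcs (isPartial_limit (degLE_map G ident)).adj (degLE_map G ident i).1

/-- A graph compatible with the gathered data agrees with the true one throughout the ball, so
`limit_congr` applies even if its degrees are large elsewhere. -/
theorem forces_gather (v : V) :
    ∃ o, Forces (ident v) (18 * G.maxDegree ^ 4)
      (gather.stateAt G ident (18 * G.maxDegree ^ 4) v).2.2 o := by
  refine ⟨(limit_map_finite G ident (ident v)).toFinset, fun H B hB hc u => ?_⟩
  rw [Set.Finite.mem_toFinset, Set.mem_ofPred_eq]
  have h1 : AllNear H (SameNbrs H (G.map ident)) (18 * G.maxDegree ^ 4) (ident v) :=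
    hc.imp fun x ⟨S, hS, hx⟩ w => (hx w).symm.trans (gather_sound G ident _ v _ hS w)
  have h2 : AllNear (G.map ident) (fun x => SameNbrs (G.map ident) H x ∧
      DegLE (G.map ident) G.maxDegree x) (18 * G.maxDegree ^ 4) (ident v) :=
    AllNear.transfer (h1.imp fun x hx => ⟨hx, fun w => (hx w).symm, degLE_map G ident x⟩)
  exact (limit_congr (degLE_map G ident) hB h2).1 u

/-- The true graph is among the compatible ones at every time, so even an early announcement is
correct. -/
theorem gather_output {t : ℕ} {v : V} {o : Finset ℕ}
    (h : gather.output (gather.stateAt G ident t v) = some o) (u : ℕ) :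
    u ∈ o ↔ limit (G.map ident) u (ident v) := by
  classical
  by_cases he : ∃ o, Forces (gather.stateAt G ident t v).1 (gather.stateAt G ident t v).2.1
      (gather.stateAt G ident t v).2.2 o
  · have ho : he.choose = o := Option.some.inj ((dif_pos he).symm.trans h)
    have hf := he.choose_spec
    rw [ho, gather_fst, gather_time] at hf
    exact hf _ _ (degLE_map G ident) (compatible_gather G ident t v) u
  · exact absurd ((dif_neg he).symm.trans h) (by simp)

theorem gather_output_ne_none (v : V) :
    gather.output (gather.stateAt G ident (18 * G.maxDegree ^ 4) v) ≠ none := by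
  classical
  have he : ∃ o, Forces (gather.stateAt G ident (18 * G.maxDegree ^ 4) v).1
      (gather.stateAt G ident (18 * G.maxDegree ^ 4) v).2.1
      (gather.stateAt G ident (18 * G.maxDegree ^ 4) v).2.2 o := by
    rw [gather_fst, gather_time]
    exact forces_gather G ident v
  intro h
  exact absurd ((dif_pos he).symm.trans h) (by simp)

theorem setOf_limit_map (v : V) :
    {u | limit (G.map ident) u (ident v)} =
      ident '' {u | limit (G.map ident) (ident u) (ident v)} := by
  ext u
  constructor
  · intro hu
    have := (isPartial_limit (degLE_map G ident)).adj _ _ hu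
    obtain ⟨w, _, rfl⟩ := Finset.mem_map.1 ((mem_nbrs G ident).2 this.symm)
    exact ⟨w, hu, rfl⟩
  · rintro ⟨w, hw, rfl⟩
    exact hw

theorem gather_finds : gather.FindsOrientationWithin G ident
    ⟨fun u v => limit (G.map ident) (ident u) (ident v)⟩ (18 * G.maxDegree ^ 4) := by
  classical
  intro v
  have hex : ∃ t, gather.output (gather.stateAt G ident t v) ≠ none :=
    ⟨_, gather_output_ne_none G ident v⟩
  obtain ⟨o, ho⟩ := Option.ne_none_iff_exists'.1 (Nat.find_spec hex)
  refine ⟨Nat.find hex, Nat.find_min' hex (gather_output_ne_none G ident v), o,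
    ⟨ho, fun s hs => not_not.1 (Nat.find_min hex hs)⟩, ?_⟩
  refine Eq.trans ?_ (setOf_limit_map G ident v)
  ext u
  exact gather_output G ident ho u

theorem indeg_limit_map (v : V) :
    indeg ⟨fun u v => limit (G.map ident) (ident u) (ident v)⟩ v =
      load (limit (G.map ident)) (ident v) := by
  rw [load, setOf_limit_map, Set.ncard_image_of_injective _ ident.injective, indeg]

theorem isStableOrientation_limit_map :
    IsStableOrientation G ⟨fun u v => limit (G.map ident) (ident u) (ident v)⟩ := by
  have hp := isPartial_limit (degLE_map G ident)
  have hadj : ∀ u v, (G.map ident).Adj (ident u) (ident v) ↔ G.Adj u v :=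
    fun u v => SimpleGraph.map_adj_apply
  refine ⟨⟨fun u v h => (hadj u v).1 (hp.adj _ _ h), fun u v h => ?_⟩, fun u v h => ?_⟩
  · rcases limit_or_limit (degLE_map G ident) ((hadj u v).2 h) with h1 | h1
    · exact .inl ⟨h1, hp.asymm _ _ h1⟩
    · exact .inr ⟨h1, hp.asymm _ _ h1⟩
  · rw [indeg_limit_map, indeg_limit_map]
    exact hp.happy _ _ h

end

end LocalAlgorithm

theorem mainTheorem1 :
    ∃ (A : LocalAlgorithm (Finset ℕ)) (C : ℕ),
      ∀ (V : Type) [Fintype V] (G : SimpleGraph V) [DecidableRel G.Adj] (ident : V ↪ ℕ),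
        ∃ D : Digraph V, IsStableOrientation G D ∧
          A.FindsOrientationWithin G ident D (C * G.maxDegree ^ 4) :=
  ⟨LocalAlgorithm.gather, 18, fun _ _ G _ ident =>
    ⟨_, LocalAlgorithm.isStableOrientation_limit_map G ident,
      LocalAlgorithm.gather_finds G ident⟩⟩
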